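/- **Conventions.** All Banach spaces are complex; $X'$ is the dual of $X$, $B_X$ its closed unit ball, and $X$ is regarded as a subspace of $X''$. A projection $P$ on a Banach space $E$ is an *L-projection* if $\|x\|=\|Px\|+\|x-Px\|$ for all $x\in E$; the range of an L-projection is called an *L-summand*. A subspace $Y\subset E$ is an *M-ideal* in $E$ if its annihilator $Y^{\perp}\subset E'$ is an L-summand in $E'$. A Banach space $X$ is *L-embedded* if it is an L-summand in $X''$, and *M-embedded* if it is an M-ideal in $X''$. A sequence $(x_n)$ of nonzero elements of $X$ *spans $\ell^1$ asymptotically* if there is a sequence $(\delta_n)$ in $[0,1)$ tending to $0$ such that $\sum_n(1-\delta_n)|\alpha_n|\le\bigl\|\sum_n\alpha_n\frac{x_n}{\|x_n\|}\bigr\|\le\sum_n|\alpha_n|$ for all finitely supported (equivalently, all absolutely summable) families of scalars $(\alpha_n)$. A topology $\tau$ on $X$ is an *abstract measure topology* if: 1. $(X,\tau)$ is a sequential space (sequentially closed sets are closed) in which every convergent sequence has a unique limit; 2. $\tau$ is weaker than the norm topology; 3. for all sequences $(x_n)$ in $X$ and all $x\in X$, $x_n\to x$ in $\tau$ if and only if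 $x_n-x\to 0$ in $\tau$; 4. every bounded sequence in $X$ that spans $\ell^1$ asymptotically $\tau$-converges to $0$; and every sequence that $\tau$-converges to $0$ is bounded and has a subsequence that spans $\ell^1$ asymptotically or tends to $0$ in norm. **Proposition.** Let $X$ be an L-embedded Banach space. Then $X$ admits exactly one abstract measure topology $\tau_\mu$, and the space $$X^{\#}=\{x'\in X' : x'|_{B_X}\text{ is }\tau_\mu\text{-continuous}\}$$ is a norm-closed subspace of $X'$, hence a Banach space, and it is M-embedded. -/

import Mathlib

open Filter Topology

/-- The norm dual `X'` of a complex normed space `X`. The name is fixed here, before any second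
topology on `X` is mentioned, so that it always refers to the norm topology of `X`. -/
abbrev NormDual (X : Type*) [NormedAddCommGroup X] [NormedSpace ℂ X] : Type _ :=
  StrongDual ℂ X

/-- The norm topology of `X`, as a term. -/
abbrev normTopology (X : Type*) [NormedAddCommGroup X] : TopologicalSpace X :=
  inferInstance

/-- A subspace `Y` of `X` is an L-summand in `X` if it is the range of an L-projection on `X`,
that is, of a projection `P` with `‖x‖ = ‖P x‖ + ‖x - P x‖` for all `x`. -/
def IsLSummand {X : Type*} [NormedAddCommGroup X] [NormedSpace ℂ X]
    (Y : Submodule ℂ X) : Prop :=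
  ∃ P : X →L[ℂ] X, IsLprojection X P ∧ LinearMap.range (P : X →ₗ[ℂ] X) = Y

/-- A subspace `Y` of `X` is an M-ideal in `X` if its annihilator `Y^⊥` in `X'` is the range of an
L-projection on `X'`. (Mathlib's `StrongDual.polarSubmodule ℂ Y` is
the space of all `f` in `X'` with `f y = 0` for all `y` in `Y`.) -/
def IsMIdeal {X : Type*} [NormedAddCommGroup X] [NormedSpace ℂ X]
    (Y : Submodule ℂ X) : Prop :=
  IsLSummand (StrongDual.polarSubmodule ℂ Y)

/-- The canonical copy of `X` in its bidual `X''`. -/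
noncomputable def canonicalCopy (X : Type*) [NormedAddCommGroup X] [NormedSpace ℂ X] :
    Submodule ℂ (NormDual (NormDual X)) :=
  LinearMap.range (NormedSpace.inclusionInDoubleDual ℂ X : X →ₗ[ℂ] NormDual (NormDual X))

/-- `X` is L-embedded if it is an L-summand in its bidual. -/
def IsLEmbedded (X : Type*) [NormedAddCommGroup X] [NormedSpace ℂ X] : Prop :=
  IsLSummand (canonicalCopy X)

/-- `X` is M-embedded if it is an M-ideal in its bidual. -/
def IsMEmbedded (X : Type*) [NormedAddCommGroup X] [NormedSpace ℂ X] : Prop :=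
  IsMIdeal (canonicalCopy X)

/-- The sequence `x` of nonzero elements spans `ℓ¹` asymptotically isometrically:
`∑ (1 - δ n) |α n| ≤ ‖∑ α n • x n / ‖x n‖‖ ≤ ∑ |α n|` for all scalars `α n`, for some sequence
`δ` in `[0, 1)` that tends to `0`. It is stated for finite sums; the inequalities for absolutely
summable `α` follow by passing to the limit. -/
def SpansL1Asymptotically {X : Type*} [NormedAddCommGroup X] [NormedSpace ℂ X]
    (x : ℕ → X) : Prop :=
  (∀ n, x n ≠ 0) ∧
    ∃ δ : ℕ → ℝ, (∀ n, 0 ≤ δ n ∧ δ n < 1) ∧ Tendsto δ atTop (𝓝 0) ∧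
      ∀ (s : Finset ℕ) (α : ℕ → ℂ),
        ∑ n ∈ s, (1 - δ n) * ‖α n‖ ≤ ‖∑ n ∈ s, α n • (((‖x n‖⁻¹ : ℝ) : ℂ) • x n)‖ ∧
        ‖∑ n ∈ s, α n • (((‖x n‖⁻¹ : ℝ) : ℂ) • x n)‖ ≤ ∑ n ∈ s, ‖α n‖

/-- The sequence `x` converges to `a` in the topology `τ`. -/
def ConvergesIn {X : Type*} (τ : TopologicalSpace X) (x : ℕ → X) (a : X) : Prop :=
  Tendsto x atTop (@nhds X τ a)

/-- `τ` is an abstract measure topology on the normed space `X`. -/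
structure IsAbstractMeasureTopology (X : Type*) [NormedAddCommGroup X] [NormedSpace ℂ X]
    (τ : TopologicalSpace X) : Prop where
  /-- `(X, τ)` is a sequential space -/
  sequential : @SequentialSpace X τ
  /-- in which every convergent sequence has a unique limit. -/
  unique_limit : ∀ (x : ℕ → X) (a b : X), ConvergesIn τ x a → ConvergesIn τ x b → a = b
  /-- `τ` is weaker than the norm topology: every `τ`-open set is norm open. -/
  weaker : ∀ U : Set X, IsOpen[τ] U → IsOpen[normTopology X] U
  /-- `τ` is translation invariant for sequences. -/
  translation : ∀ (x : ℕ → X) (a : X),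
    ConvergesIn τ x a ↔ ConvergesIn τ (fun n => x n - a) 0
  /-- Bounded sequences that span `ℓ¹` asymptotically are `τ`-null. -/
  null_of_spans : ∀ x : ℕ → X, (∃ C : ℝ, ∀ n, ‖x n‖ ≤ C) → SpansL1Asymptotically x →
    ConvergesIn τ x 0
  /-- `τ`-null sequences are bounded, -/
  bounded_of_null : ∀ x : ℕ → X, ConvergesIn τ x 0 → ∃ C : ℝ, ∀ n, ‖x n‖ ≤ C
  /-- and have a subsequence that spans `ℓ¹` asymptotically or is norm null. -/
  subseq_of_null : ∀ x : ℕ → X, ConvergesIn τ x 0 → ∃ φ : ℕ → ℕ, StrictMono φ ∧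
    (SpansL1Asymptotically (x ∘ φ) ∨ Tendsto (fun n => ‖x (φ n)‖) atTop (𝓝 0))

/-- `X^#` (for the topology `τ` on `X`): the space of all `f` in `X'` whose restriction to the
closed unit ball of `X` is `τ`-continuous. It carries the norm of `X'`. -/
def sharpDual (X : Type*) [NormedAddCommGroup X] [NormedSpace ℂ X]
    (τ : TopologicalSpace X) : Submodule ℂ (NormDual X) where
  carrier := {f | @ContinuousOn X ℂ τ _ (fun x => f x) (Metric.closedBall 0 1)}
  add_mem' := fun hf hg => ContinuousOn.add hf hg
  zero_mem' := continuousOn_const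
  smul_mem' := fun c _ hf => ContinuousOn.const_smul hf c

/-! Let P be the L-projection of X'' onto X. Everything rests on a two-way link between ker P and
sequences in X that span ℓ¹ asymptotically. On the one hand, weak-star cluster points of such
bounded sequences lie in ker P (`IsLProjectionOntoCopy.apply_eq_zero_of_tendsto`, for normalized
ones): disjoint convex blocks are almost at distance 2, separation carries this bound to the limit
z, and additivity of the norm leaves no room for P z. On the other hand, a norm one z in ker P
satisfies ‖x + tz‖ = ‖x‖ + |t| for x in X. Weak-star lower semicontinuity and compactness of
finite-dimensional spheres then allow an asymptotic ℓ¹-sequence to be chosen inductively whose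
values at a given functional f are close to z(f)
(`IsLProjectionOntoCopy.exists_spansL1Asymptotically`).

The axioms leave only one possible sequential convergence, that of `IsMeasureNull` differences, and
a sequential topology is determined by its convergent sequences; hence uniqueness. For existence,
this convergence is turned into a topology. Its limits are unique because cluster points of x_n - a
and x_n - b along one ultrafilter differ by a - b, and both lie in ker P.

By the same link X^# is the annihilator of ker P in X' (`mem_sharpDual_iff`), hence closed.
Restriction to X^# is a metric surjection of X onto (X^#)', whose adjoint embeds (X^#)''
isometrically in X'. Extending an element of (X^#)''' to X'' and splitting it by P gives the norm
inequality for the Dixmier projection. -/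

/-! ### Weak-star limits in the bidual: separation, compactness, density -/

/-- A functional whose real part is at most `c` on the ball of radius `t` has norm at most `c / t`. -/
theorem norm_le_div_of_re_le {X : Type*} [NormedAddCommGroup X] [NormedSpace ℂ X]
    (f : NormDual X) {t c : ℝ} (ht : 0 < t) (h : ∀ v : X, ‖v‖ ≤ t → (f v).re ≤ c) :
    ‖f‖ ≤ c / t := by
  refine ContinuousLinearMap.opNorm_bound_of_ball_bound ht _ f fun v hv => ?_
  rw [mem_closedBall_zero_iff] at hv
  obtain ⟨w, hw, hwv⟩ : ∃ w : ℂ, ‖w‖ ≤ 1 ∧ w * f v = (‖f v‖ : ℂ) := by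
    by_cases h0 : f v = 0
    · exact ⟨0, by simp, by simp [h0]⟩
    · refine ⟨(‖f v‖ : ℂ) / f v, by simp [h0], by field_simp⟩
  have h1 := h (w • v) (by
    rw [norm_smul]
    calc ‖w‖ * ‖v‖ ≤ 1 * ‖v‖ := by gcongr
      _ ≤ t := by linarith)
  rwa [map_smul, smul_eq_mul, hwv, Complex.ofReal_re] at h1

/-- If `u` lies eventually in a convex set at distance at least `r` from `a` and converges weak-star
to `z` in the bidual, then `z` has distance at least `r` from `a`. -/
theorem le_norm_inclusion_sub_of_tendsto {X ι : Type*} [NormedAddCommGroup X] [NormedSpace ℂ X]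
    {C : Set X} (hC : Convex ℝ C) {F : Filter ι} [F.NeBot] {u : ι → X} (hu : ∀ᶠ i in F, u i ∈ C)
    {z : NormDual (NormDual X)} (hz : ∀ f : NormDual X, Tendsto (fun i => f (u i)) F (𝓝 (z f)))
    {a : X} {r : ℝ} (hr : ∀ y ∈ C, r ≤ ‖a - y‖) :
    r ≤ ‖NormedSpace.inclusionInDoubleDual ℂ X a - z‖ := by
  -- The separation is from the open ball of radius `r`; closed balls of radius `t < r` fit inside
  -- it and give `t * ‖f‖ ≤ c - Re f a`.
  refine le_of_forall_lt_imp_le_of_dense fun t ht => ?_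
  rcases le_or_gt t 0 with ht0 | ht0
  · exact ht0.trans (norm_nonneg (NormedSpace.inclusionInDoubleDual ℂ X a - z))
  have hdisj : Disjoint (Metric.ball a r) C := by
    rw [Set.disjoint_left]
    intro y hy hyC
    rw [Metric.mem_ball, dist_eq_norm, norm_sub_rev] at hy
    exact absurd (hr y hyC) (not_le.2 hy)
  obtain ⟨f, c, hf1, hf2⟩ := RCLike.geometric_hahn_banach_open (𝕜 := ℂ) (convex_ball a r)
    Metric.isOpen_ball hC hdisj
  have hcz : c ≤ (z f).re :=
    ge_of_tendsto ((Complex.continuous_re.tendsto _).comp (hz f))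
      (hu.mono fun i hi => hf2 _ hi)
  have hn : ‖f‖ ≤ (c - (f a).re) / t := by
    refine norm_le_div_of_re_le f ht0 fun v hv => ?_
    have := hf1 (a + v) (by
      rw [mem_ball_iff_norm, add_sub_cancel_left]
      exact hv.trans_lt ht)
    simp at this
    linarith
  rw [le_div_iff₀ ht0] at hn
  have hfpos : 0 < ‖f‖ := by
    rw [norm_pos_iff]
    rintro rfl
    have h1 := hf1 a (Metric.mem_ball_self (ht0.trans ht))
    simp at h1 hcz
    linarith
  have h3 : ((z - NormedSpace.inclusionInDoubleDual ℂ X a) f).re ≤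
      ‖NormedSpace.inclusionInDoubleDual ℂ X a - z‖ * ‖f‖ := by
    rw [norm_sub_rev (NormedSpace.inclusionInDoubleDual ℂ X a) z]
    exact (Complex.re_le_norm _).trans (ContinuousLinearMap.le_opNorm _ _)
  have h4 : ((z - NormedSpace.inclusionInDoubleDual ℂ X a) f).re = (z f).re - (f a).re := by
    simp
  refine le_of_mul_le_mul_right ?_ hfpos
  linarith

/-- Weak-star limits of sequences in the ball of radius `r` lie in the ball of radius `r`. -/
theorem norm_le_of_tendsto_apply {X ι : Type*} [NormedAddCommGroup X] [NormedSpace ℂ X]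
    {F : Filter ι} [F.NeBot] {u : ι → X} {r : ℝ} (hr : 0 ≤ r) (hu : ∀ᶠ i in F, ‖u i‖ ≤ r)
    {z : NormDual (NormDual X)} (hz : ∀ f : NormDual X, Tendsto (fun i => f (u i)) F (𝓝 (z f))) :
    ‖z‖ ≤ r := by
  refine ContinuousLinearMap.opNorm_le_bound _ hr fun f => ?_
  refine le_of_tendsto (hz f).norm (hu.mono fun i hi => ?_)
  calc ‖f (u i)‖ ≤ ‖f‖ * ‖u i‖ := f.le_opNorm _
    _ ≤ ‖f‖ * r := by gcongr
    _ = r * ‖f‖ := mul_comm _ _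

/-- Along an ultrafilter every bounded family converges weak-star in the bidual. -/
theorem exists_tendsto_apply_of_bounded {X ι : Type*} [NormedAddCommGroup X] [NormedSpace ℂ X]
    (U : Ultrafilter ι) {u : ι → X} {r : ℝ} (hu : ∀ i, ‖u i‖ ≤ r) :
    ∃ z : NormDual (NormDual X), ∀ f : NormDual X,
      Tendsto (fun i => f (u i)) U (𝓝 (z f)) := by
  let g : ι → WeakDual ℂ (NormDual X) :=
    fun i => StrongDual.toWeakDual (NormedSpace.inclusionInDoubleDual ℂ X (u i))
  have hK := WeakDual.isCompact_closedBall (𝕜 := ℂ) (E := NormDual X) 0 r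
  have hg : ∀ i, g i ∈ (WeakDual.toStrongDual ⁻¹'
      Metric.closedBall (0 : StrongDual ℂ (NormDual X)) r) := by
    intro i
    rw [Set.mem_preimage, mem_closedBall_zero_iff (E := StrongDual ℂ (NormDual X))]
    exact (NormedSpace.double_dual_bound ℂ X (u i)).trans (hu i)
  obtain ⟨z, -, hz⟩ := hK.ultrafilter_le_nhds (U.map g)
    (le_principal_iff.2 (Filter.Eventually.of_forall (f := (U : Filter ι)) hg))
  refine ⟨WeakDual.toStrongDual z, fun f => ?_⟩
  exact ((WeakDual.eval_continuous f).tendsto z).comp (show Tendsto g U (𝓝 z) from hz)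

/-- Goldstine's theorem: each point of the unit ball of the bidual is the weak-star limit of a
filter on the unit ball. -/
theorem exists_filter_tendsto_apply {X : Type*} [NormedAddCommGroup X] [NormedSpace ℂ X]
    {z : NormDual (NormDual X)} (hz : ‖z‖ ≤ 1) :
    ∃ F : Filter X, F.NeBot ∧ (∀ᶠ x in F, ‖x‖ ≤ 1) ∧
      ∀ f : NormDual X, Tendsto (fun x => f x) F (𝓝 (z f)) := by
  let F : Filter X := comap (fun x (f : NormDual X) => f x) (𝓝 fun f => z f) ⊓
    𝓟 (Metric.closedBall 0 1)
  refine ⟨F, ?_, ?_, fun f => ?_⟩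
  · rw [← frequently_mem_iff_neBot, (Filter.HasBasis.comap _ (𝓝 _).basis_sets).frequently_iff]
    intro V hV
    rw [nhds_pi, mem_pi] at hV
    obtain ⟨I, hI, t, ht, hIt⟩ := hV
    have := hI.to_subtype
    classical
    cases nonempty_fintype I
    let T : X →L[ℂ] (I → ℂ) := ContinuousLinearMap.pi fun f => f.1
    have hconv : Convex ℝ (T '' Metric.closedBall 0 1) :=
      (convex_closedBall 0 1).linear_image (T.restrictScalars ℝ : X →ₗ[ℝ] (I → ℂ))
    have hmem : (fun f : I => z f.1) ∈ closure (T '' Metric.closedBall 0 1) := by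
      by_contra hnot
      obtain ⟨l, c, hl1, hl2⟩ := RCLike.geometric_hahn_banach_closed_point (𝕜 := ℂ)
        hconv.closure isClosed_closure hnot
      let g : NormDual X := l ∘L T
      -- The separating functional on the finite product pulls back to `g` in X' with `‖g‖ ≤ c`,
      -- while `Re (z g) > c` and `‖z‖ ≤ 1`.
      have hg : ‖g‖ ≤ c / 1 := norm_le_div_of_re_le g one_pos fun v hv =>
        (hl1 _ (subset_closure ⟨v, mem_closedBall_zero_iff.2 hv, rfl⟩)).le
      have hgsum : g = ∑ i : I, l (fun j => if i = j then 1 else 0) • i.1 := by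
        ext x
        have := LinearMap.pi_apply_eq_sum_univ (l : (I → ℂ) →ₗ[ℂ] ℂ) (T x)
        simpa [g, T, mul_comm] using this
      have hlz : l (fun f : I => z f.1) = z g := by
        have := LinearMap.pi_apply_eq_sum_univ (l : (I → ℂ) →ₗ[ℂ] ℂ) (fun f : I => z f.1)
        simpa [hgsum, mul_comm] using this
      have h1 : (z g).re ≤ 1 * ‖g‖ :=
        (Complex.re_le_norm _).trans ((z.le_opNorm g).trans (by gcongr))
      rw [hlz] at hl2
      simp at hl2 hg
      linarith
    rw [mem_closure_iff_nhds] at hmem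
    obtain ⟨-, hy, x, hx, rfl⟩ := hmem (Set.univ.pi fun f : I => t f.1)
      (set_pi_mem_nhds Set.finite_univ fun f _ => ht f.1)
    exact ⟨x, hIt fun f hf => hy ⟨f, hf⟩ trivial, hx⟩
  · filter_upwards [(inf_le_right : F ≤ _) (mem_principal_self _)] with x hx
    exact mem_closedBall_zero_iff.1 hx
  · have h : Tendsto (fun x (f : NormDual X) => f x) F (𝓝 fun f => z f) :=
      tendsto_comap.mono_left inf_le_left
    exact tendsto_pi_nhds.1 h f

/-! ### From sequential convergence to a topology -/

/-- A notion of sequential convergence with unique limits that is passed on to subsequences and has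
the Urysohn subsequence property is the convergence of sequences in a sequential topology. -/
theorem exists_sequentialSpace_of_convergence {X : Type*} (Conv : (ℕ → X) → X → Prop)
    (hconst : ∀ a, Conv (fun _ => a) a)
    (hsub : ∀ x a (φ : ℕ → ℕ), StrictMono φ → Conv x a → Conv (x ∘ φ) a)
    (hury : ∀ x a, (∀ φ : ℕ → ℕ, StrictMono φ → ∃ ψ : ℕ → ℕ, StrictMono ψ ∧ Conv ((x ∘ φ) ∘ ψ) a) → Conv x a)
    (huniq : ∀ x a b, Conv x a → Conv x b → a = b) :
    ∃ τ : TopologicalSpace X, @SequentialSpace X τ ∧ ∀ x a, ConvergesIn τ x a ↔ Conv x a := by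
  let τ : TopologicalSpace X :=
    { IsOpen := fun U => ∀ x a, a ∈ U → Conv x a → ∀ᶠ n in atTop, x n ∈ U
      isOpen_univ := fun x a _ _ => Eventually.of_forall fun _ => trivial
      isOpen_inter := fun U V hU hV x a ha hx => (hU x a ha.1 hx).and (hV x a ha.2 hx)
      isOpen_sUnion := fun S hS x a ⟨U, hUS, haU⟩ hx =>
        (hS U hUS x a haU hx).mono fun n hn => ⟨U, hUS, hn⟩ }
  have htendsto : ∀ x a, Conv x a → ConvergesIn τ x a := fun x a hx =>
    (@tendsto_nhds X τ ℕ a x atTop).2 fun U hU ha => hU x a ha hx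
  have hopen : ∀ F : Set X, (∀ x a, (∀ n, x n ∈ F) → Conv x a → a ∈ F) → IsOpen[τ] Fᶜ := by
    intro F hF x a ha hx
    by_contra hn
    obtain ⟨φ, hφ, hφF⟩ := extraction_of_frequently_atTop (not_eventually.1 hn)
    exact ha (hF (x ∘ φ) a (fun n => not_not.1 (hφF n)) (hsub x a φ hφ hx))
  refine ⟨τ, ?_, fun x a => ⟨fun hx => ?_, htendsto x a⟩⟩
  · refine @SequentialSpace.mk X τ fun F hF => ?_
    refine (@isOpen_compl_iff X F τ).1 (hopen F fun x a hx hxa => ?_)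
    exact hF hx (htendsto x a hxa)
  by_contra hnot
  obtain ⟨φ, hφ, hφn⟩ : ∃ φ : ℕ → ℕ, StrictMono φ ∧ ∀ ψ : ℕ → ℕ, StrictMono ψ → ¬ Conv ((x ∘ φ) ∘ ψ) a := by
    by_contra! h
    exact hnot (hury x a h)
  -- Uniqueness of limits lets `B`, which contains every limit of a subsequence of `w`, be empty or
  -- a singleton after passing to a subsequence.
  obtain ⟨w, hw, hwn, B, hB, hBlim⟩ : ∃ w : ℕ → X, ConvergesIn τ w a ∧
      (∀ ψ : ℕ → ℕ, StrictMono ψ → ¬ Conv (w ∘ ψ) a) ∧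
      ∃ B : Set X, B.Finite ∧ ∀ (ψ : ℕ → ℕ) b, StrictMono ψ → Conv (w ∘ ψ) b → b ∈ B := by
    have hxφ : ConvergesIn τ (x ∘ φ) a := hx.comp hφ.tendsto_atTop
    by_cases h : ∃ (ψ : ℕ → ℕ) (b : X), StrictMono ψ ∧ Conv ((x ∘ φ) ∘ ψ) b
    · obtain ⟨ψ, b, hψ, hb⟩ := h
      refine ⟨(x ∘ φ) ∘ ψ, hxφ.comp hψ.tendsto_atTop,
        fun ψ' hψ' => hφn (ψ ∘ ψ') (hψ.comp hψ'), {b}, Set.finite_singleton b, ?_⟩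
      exact fun ψ' c hψ' hc => huniq _ c b hc (hsub _ b ψ' hψ' hb)
    · push Not at h
      exact ⟨x ∘ φ, hxφ, hφn, ∅, Set.finite_empty, fun ψ b hψ hb => absurd hb (h ψ b hψ)⟩
  have hwB : ∀ᶠ n in atTop, w n ≠ a := by
    by_contra h
    obtain ⟨ψ, hψ, hψa⟩ := extraction_of_frequently_atTop (not_eventually.1 h)
    refine hwn ψ hψ ?_
    convert hconst a using 1
    exact funext fun n => not_not.1 (hψa n)
  obtain ⟨N, hN⟩ := eventually_atTop.1 hwB
  -- The complement of `F` will be an open neighbourhood of `a` that misses a tail of `w`,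
  -- contradicting convergence.
  let F : Set X := (B \ {a}) ∪ w '' Set.Ici N
  have haF : a ∈ Fᶜ := by
    rintro (h | ⟨n, hn, h⟩)
    · exact h.2 rfl
    · exact hN n hn h
  have hFopen : IsOpen[τ] Fᶜ := by
    refine hopen F fun y c hy hc => ?_
    -- A value repeated infinitely often must be the limit `c`. Otherwise `y` eventually leaves the
    -- finite set `B` and shares a subsequence with `w`, so `c` lies in `B` and is not `a`.
    by_cases hrep : ∃ p, ∃ᶠ n in atTop, y n = p
    · obtain ⟨p, hp⟩ := hrep
      obtain ⟨ψ, hψ, hψp⟩ := extraction_of_frequently_atTop hp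
      have h1 := hsub y c ψ hψ hc
      rw [show y ∘ ψ = fun _ => p from funext hψp] at h1
      rw [huniq _ c p h1 (hconst p), ← hψp 0]
      exact hy _
    · push Not at hrep
      have hyB : ∀ᶠ n in atTop, y n ∉ B := by
        have := (eventually_all_finite hB).2 fun p _ => hrep p
        exact this.mono fun n hn hnB => hn _ hnB rfl
      have hk : ∀ n, ∃ k, y n ∉ B → y n = w k := by
        intro n
        rcases hy n with h | ⟨k, -, h⟩
        · exact ⟨0, fun h' => absurd h.1 h'⟩
        · exact ⟨k, fun _ => h.symm⟩
      choose k hk using hk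
      have hktop : Tendsto k atTop atTop := by
        refine tendsto_atTop.2 fun K => ?_
        have h1 := (eventually_all_finite (Set.finite_Iio K)).2 fun i _ => hrep (w i)
        filter_upwards [h1, hyB] with n hn hnB
        by_contra hlt
        exact hn (k n) (not_le.1 hlt) (hk n hnB)
      obtain ⟨M, hM⟩ := eventually_atTop.1 hyB
      obtain ⟨ψ, hψ, hkψ⟩ := strictMono_subseq_of_tendsto_atTop
        (hktop.comp (tendsto_add_atTop_nat M))
      have hyw : y ∘ (fun n => ψ n + M) = w ∘ (k ∘ (fun n => n + M) ∘ ψ) :=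
        funext fun n => hk _ (hM _ (Nat.le_add_left _ _))
      have h2 := hsub y c (fun n => ψ n + M) (hψ.add_const M) hc
      rw [hyw] at h2
      refine Or.inl ⟨hBlim _ c hkψ h2, ?_⟩
      rintro rfl
      exact hwn _ hkψ h2
  have hev := (@tendsto_nhds X τ ℕ a w atTop).1 hw _ hFopen haF
  obtain ⟨M, hM⟩ := eventually_atTop.1 hev
  exact hM (max M N) (le_max_left _ _) (Or.inr ⟨_, Set.mem_Ici.2 (le_max_right _ _), rfl⟩)

/-! ### Asymptotic ℓ¹-sequences cluster in the complement of X -/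

/-- The vector `x n` divided by its norm. -/
noncomputable def normalizedSeq {X : Type*} [NormedAddCommGroup X] [NormedSpace ℂ X]
    (x : ℕ → X) (n : ℕ) : X :=
  ((‖x n‖⁻¹ : ℝ) : ℂ) • x n

theorem norm_normalizedSeq_le {X : Type*} [NormedAddCommGroup X] [NormedSpace ℂ X]
    (x : ℕ → X) (n : ℕ) : ‖normalizedSeq x n‖ ≤ 1 := by
  rw [normalizedSeq, norm_smul, Complex.norm_real, norm_inv, norm_norm]
  exact inv_mul_le_one

/-- Finitely supported convex weights on `[m, ∞)`. -/
def tailWeights (m : ℕ) : Set (ℕ →₀ ℝ) :=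
  {α | (∀ n, 0 ≤ α n) ∧ (∀ n < m, α n = 0) ∧ α.sum (fun _ r => r) = 1}

theorem convex_tailWeights (m : ℕ) : Convex ℝ (tailWeights m) := by
  rintro α ⟨hα0, hαm, hα⟩ β ⟨hβ0, hβm, hβ⟩ a b ha hb hab
  refine ⟨fun n => ?_, fun n hn => ?_, ?_⟩
  · simpa using add_nonneg (mul_nonneg ha (hα0 n)) (mul_nonneg hb (hβ0 n))
  · simp [hαm n hn, hβm n hn]
  · rw [Finsupp.sum_add_index' (fun _ => rfl) (fun _ _ _ => rfl),
      Finsupp.sum_smul_index (fun _ => rfl), Finsupp.sum_smul_index (fun _ => rfl),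
      ← Finsupp.mul_sum, ← Finsupp.mul_sum, hα, hβ]
    simpa using hab

theorem single_mem_tailWeights {m n : ℕ} (h : m ≤ n) :
    Finsupp.single n (1 : ℝ) ∈ tailWeights m := by
  refine ⟨fun k => ?_, fun k hk => ?_, by simp⟩
  · rw [Finsupp.single_apply]; split_ifs <;> simp
  · rw [Finsupp.single_apply, if_neg (by omega)]

/-- Convex combinations with disjoint supports of an asymptotic `ℓ¹`-sequence are almost at
distance `2`. -/
theorem le_norm_linearCombination_sub {X : Type*} [NormedAddCommGroup X] [NormedSpace ℂ X]
    {e : ℕ → X} {δ : ℕ → ℝ}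
    (he : ∀ (s : Finset ℕ) (α : ℕ → ℂ), ∑ n ∈ s, (1 - δ n) * ‖α n‖ ≤ ‖∑ n ∈ s, α n • e n‖)
    {m k : ℕ} (hmk : m ≤ k) {ε : ℝ} (hε : ∀ n, m ≤ n → δ n ≤ ε) {α β : ℕ →₀ ℝ}
    (hα : α ∈ tailWeights m) (hβ : β ∈ tailWeights k) (hαk : ∀ n, k ≤ n → α n = 0) :
    2 * (1 - ε) ≤ ‖Finsupp.linearCombination ℝ e α - Finsupp.linearCombination ℝ e β‖ := by
  set s := α.support ∪ β.support
  have h1 : Finsupp.linearCombination ℝ e α - Finsupp.linearCombination ℝ e β =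
      ∑ n ∈ s, ((α n - β n : ℝ) : ℂ) • e n := by
    rw [Finsupp.linearCombination_apply, Finsupp.linearCombination_apply,
      Finsupp.sum_of_support_subset α Finset.subset_union_left _ (by simp),
      Finsupp.sum_of_support_subset β Finset.subset_union_right _ (by simp),
      ← Finset.sum_sub_distrib]
    refine Finset.sum_congr rfl fun n _ => ?_
    rw [← sub_smul, Complex.coe_smul]
  have h2 : 2 * (1 - ε) = ∑ n ∈ s, (1 - ε) * (α n + β n) := by
    rw [← Finset.mul_sum, Finset.sum_add_distrib,
      ← Finsupp.sum_of_support_subset α Finset.subset_union_left (fun _ r => r) (by simp),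
      ← Finsupp.sum_of_support_subset β Finset.subset_union_right (fun _ r => r) (by simp),
      hα.2.2, hβ.2.2]
    ring
  rw [h1, h2]
  refine le_trans (Finset.sum_le_sum fun n _ => ?_) (he s fun n => ((α n - β n : ℝ) : ℂ))
  rw [Complex.norm_real, Real.norm_eq_abs]
  rcases lt_or_ge n m with hn | hn
  · simp [hα.2.1 n hn, hβ.2.1 n (hn.trans_le hmk)]
  · have h3 : |α n - β n| = α n + β n := by
      rcases lt_or_ge n k with hnk | hnk
      · rw [hβ.2.1 n hnk, sub_zero, add_zero, abs_of_nonneg (hα.1 n)]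
      · rw [hαk n hnk, zero_sub, zero_add, abs_neg, abs_of_nonneg (hβ.1 n)]
    rw [h3]
    have := hε n hn
    exact mul_le_mul_of_nonneg_right (by linarith) (add_nonneg (hα.1 n) (hβ.1 n))

theorem norm_inclusionInDoubleDual {X : Type*} [NormedAddCommGroup X] [NormedSpace ℂ X] (x : X) :
    ‖NormedSpace.inclusionInDoubleDual ℂ X x‖ = ‖x‖ :=
  (NormedSpace.inclusionInDoubleDualLi ℂ (E := X)).norm_map x

/-- `P` is an L-projection of the bidual `X''` onto the canonical copy of `X`. -/
structure IsLProjectionOntoCopy {X : Type*} [NormedAddCommGroup X] [NormedSpace ℂ X]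
    (P : NormDual (NormDual X) →L[ℂ] NormDual (NormDual X)) : Prop where
  apply_inclusion : ∀ x : X,
    P (NormedSpace.inclusionInDoubleDual ℂ X x) = NormedSpace.inclusionInDoubleDual ℂ X x
  exists_eq : ∀ z, ∃ x : X, P z = NormedSpace.inclusionInDoubleDual ℂ X x
  norm_eq : ∀ z, ‖z‖ = ‖P z‖ + ‖z - P z‖

theorem IsLEmbedded.exists_projection {X : Type*} [NormedAddCommGroup X] [NormedSpace ℂ X]
    (hX : IsLEmbedded X) :
    ∃ P : NormDual (NormDual X) →L[ℂ] NormDual (NormDual X), IsLProjectionOntoCopy P := by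
  obtain ⟨P, hP, hr⟩ := hX
  refine ⟨P, fun x => ?_, fun z => ?_, fun z => hP.Lnorm z⟩
  · have : NormedSpace.inclusionInDoubleDual ℂ X x ∈
        LinearMap.range (P : NormDual (NormDual X) →ₗ[ℂ] NormDual (NormDual X)) := by
      rw [hr]; exact ⟨x, rfl⟩
    obtain ⟨w, hw⟩ := this
    rw [← hw]
    exact congrArg (fun Q => Q w) hP.proj
  · have : P z ∈ canonicalCopy X := by
      rw [← hr]; exact ⟨z, rfl⟩
    obtain ⟨x, hx⟩ := this
    exact ⟨x, hx.symm⟩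

/-- Weak-star cluster points of a normalized asymptotic `ℓ¹`-sequence lie in the complement of
`X`. -/
theorem IsLProjectionOntoCopy.apply_eq_zero_of_tendsto {X : Type*} [NormedAddCommGroup X]
    [NormedSpace ℂ X] {P : NormDual (NormDual X) →L[ℂ] NormDual (NormDual X)}
    (hP : IsLProjectionOntoCopy P) {e : ℕ → X} (he1 : ∀ n, ‖e n‖ ≤ 1) {δ : ℕ → ℝ}
    (hδ : Tendsto δ atTop (𝓝 0))
    (he : ∀ (s : Finset ℕ) (α : ℕ → ℂ), ∑ n ∈ s, (1 - δ n) * ‖α n‖ ≤ ‖∑ n ∈ s, α n • e n‖)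
    {F : Filter ℕ} [F.NeBot] (hF : F ≤ atTop) {z : NormDual (NormDual X)}
    (hz : ∀ f : NormDual X, Tendsto (fun n => f (e n)) F (𝓝 (z f))) :
    P z = 0 := by
  have hconv : ∀ m, Convex ℝ (Finsupp.linearCombination ℝ e '' tailWeights m) := fun m =>
    (convex_tailWeights m).linear_image _
  have hmem : ∀ m, ∀ᶠ n in F, e n ∈ Finsupp.linearCombination ℝ e '' tailWeights m := fun m =>
    ((eventually_ge_atTop m).mono fun n hn =>
      ⟨_, single_mem_tailWeights hn, by simp⟩).filter_mono hF
  have hz1 : ‖z‖ ≤ 1 :=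
    norm_le_of_tendsto_apply zero_le_one (Eventually.of_forall he1) hz
  obtain ⟨a, ha⟩ := hP.exists_eq z
  have hzn := hP.norm_eq z
  -- Separation is used twice: first the far block tends to `z`, then the near block does. This
  -- gives `2 * (1 - ε) - ‖z - P z‖ ≤ ‖a - z‖ = ‖z - P z‖`.
  have key : ∀ ε > 0, 1 - ε ≤ ‖z - P z‖ := by
    intro ε hε
    obtain ⟨m, hm⟩ := eventually_atTop.1 (hδ.eventually_le_const hε)
    have h1 : ∀ α ∈ tailWeights m, 2 * (1 - ε) - ‖z - P z‖ ≤
        ‖a - Finsupp.linearCombination ℝ e α‖ := by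
      intro α hα
      set y := Finsupp.linearCombination ℝ e α
      obtain ⟨k, hk⟩ := α.support.exists_nat_subset_range
      have hαk : ∀ n, max m k ≤ n → α n = 0 := fun n hn => by
        by_contra h
        have := Finset.mem_range.1 (hk (Finsupp.mem_support_iff.2 h))
        omega
      have h2 : 2 * (1 - ε) ≤ ‖NormedSpace.inclusionInDoubleDual ℂ X y - z‖ := by
        refine le_norm_inclusion_sub_of_tendsto (hconv (max m k)) (hmem (max m k)) hz ?_
        rintro _ ⟨β, hβ, rfl⟩
        exact le_norm_linearCombination_sub he (le_max_left m k) hm hα hβ hαk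
      have h3 := hP.norm_eq (NormedSpace.inclusionInDoubleDual ℂ X y - z)
      rw [map_sub, hP.apply_inclusion, sub_sub_sub_cancel_left, ha, ← map_sub,
        norm_inclusionInDoubleDual (y - a), norm_sub_rev y a,
        ← ha, norm_sub_rev (P z) z] at h3
      linarith
    have h4 : 2 * (1 - ε) - ‖z - P z‖ ≤ ‖NormedSpace.inclusionInDoubleDual ℂ X a - z‖ := by
      refine le_norm_inclusion_sub_of_tendsto (hconv m) (hmem m) hz ?_
      rintro _ ⟨α, hα, rfl⟩
      exact h1 α hα
    rw [← ha, norm_sub_rev (P z) z] at h4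
    linarith
  have h5 : 1 ≤ ‖z - P z‖ := le_of_forall_pos_le_add fun ε hε => by linarith [key ε hε]
  have h6 : ‖P z‖ ≤ 0 := by linarith
  exact norm_le_zero_iff.1 h6

/-- Weak-star cluster points of a bounded asymptotic `ℓ¹`-sequence lie in the complement of `X`. -/
theorem IsLProjectionOntoCopy.apply_eq_zero_of_spans {X : Type*} [NormedAddCommGroup X]
    [NormedSpace ℂ X] {P : NormDual (NormDual X) →L[ℂ] NormDual (NormDual X)}
    (hP : IsLProjectionOntoCopy P) {x : ℕ → X} {C : ℝ} (hC : ∀ n, ‖x n‖ ≤ C)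
    (hx : SpansL1Asymptotically x) {U : Ultrafilter ℕ} (hU : (U : Filter ℕ) ≤ atTop)
    {z : NormDual (NormDual X)} (hz : ∀ f : NormDual X, Tendsto (fun n => f (x n)) U (𝓝 (z f))) :
    P z = 0 := by
  obtain ⟨hx0, δ, -, hδ, hb⟩ := hx
  obtain ⟨w, hw⟩ := exists_tendsto_apply_of_bounded U (norm_normalizedSeq_le x)
  have hPw : P w = 0 := hP.apply_eq_zero_of_tendsto (norm_normalizedSeq_le x) hδ
    (fun s α => (hb s α).1) hU hw
  -- Along the ultrafilter the norms converge to some `c`, possibly 0, so the cluster point is `c`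
  -- times that of the normalized sequence.
  obtain ⟨c, -, hc⟩ := (isCompact_Icc (a := (0 : ℝ)) (b := C)).ultrafilter_le_nhds
    (U.map fun n => ‖x n‖) (le_principal_iff.2
      (Eventually.of_forall (f := (U : Filter ℕ)) fun n => ⟨norm_nonneg (x n), hC n⟩))
  have hc' : Tendsto (fun n => ((‖x n‖ : ℝ) : ℂ)) U (𝓝 (c : ℂ)) :=
    (Complex.continuous_ofReal.tendsto c).comp
      (show Tendsto (fun n => ‖x n‖) U (𝓝 c) from hc)
  have hzw : z = (c : ℂ) • w := by
    ext f
    refine tendsto_nhds_unique (hz f) ?_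
    refine (hc'.mul (hw f)).congr fun n => ?_
    have : ((‖x n‖ : ℝ) : ℂ) ≠ 0 := by simpa using hx0 n
    rw [normalizedSeq, map_smul, smul_eq_mul, ← mul_assoc, Complex.ofReal_inv,
      mul_inv_cancel₀ this, one_mul]
  rw [hzw, map_smul, hPw]
  exact smul_zero (A := NormDual (NormDual X)) (c : ℂ)

theorem SpansL1Asymptotically.comp {X : Type*} [NormedAddCommGroup X] [NormedSpace ℂ X]
    {x : ℕ → X} (hx : SpansL1Asymptotically x) {φ : ℕ → ℕ} (hφ : StrictMono φ) :
    SpansL1Asymptotically (x ∘ φ) := by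
  obtain ⟨hx0, δ, hδ, hδ0, hb⟩ := hx
  refine ⟨fun n => hx0 _, δ ∘ φ, fun n => hδ _, hδ0.comp hφ.tendsto_atTop, fun s α => ?_⟩
  have h := hb (s.map ⟨φ, hφ.injective⟩) (Function.extend φ α 0)
  simpa only [Finset.sum_map, Function.Embedding.coeFn_mk, hφ.injective.extend_apply,
    Function.comp_apply] using h

/-! ### Measure-null sequences; existence and uniqueness of the topology -/

/-- Bounded sequences all of whose subsequences have a further subsequence that spans `ℓ¹`
asymptotically or is norm null. -/
def IsMeasureNull {X : Type*} [NormedAddCommGroup X] [NormedSpace ℂ X] (x : ℕ → X) : Prop :=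
  (∃ C : ℝ, ∀ n, ‖x n‖ ≤ C) ∧ ∀ φ : ℕ → ℕ, StrictMono φ → ∃ ψ : ℕ → ℕ, StrictMono ψ ∧
    (SpansL1Asymptotically ((x ∘ φ) ∘ ψ) ∨
      Tendsto (fun n => ‖((x ∘ φ) ∘ ψ) n‖) atTop (𝓝 0))

theorem IsMeasureNull.comp {X : Type*} [NormedAddCommGroup X] [NormedSpace ℂ X] {x : ℕ → X}
    (hx : IsMeasureNull x) {φ : ℕ → ℕ} (hφ : StrictMono φ) : IsMeasureNull (x ∘ φ) :=
  ⟨hx.1.imp fun _ hC _ => hC _, fun ψ hψ => hx.2 (φ ∘ ψ) (hφ.comp hψ)⟩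

theorem isMeasureNull_of_spans {X : Type*} [NormedAddCommGroup X] [NormedSpace ℂ X] {x : ℕ → X}
    {C : ℝ} (hC : ∀ n, ‖x n‖ ≤ C) (hx : SpansL1Asymptotically x) : IsMeasureNull x :=
  ⟨⟨C, hC⟩, fun _ hφ => ⟨id, strictMono_id, Or.inl (hx.comp hφ)⟩⟩

theorem isMeasureNull_of_tendsto {X : Type*} [NormedAddCommGroup X] [NormedSpace ℂ X] {x : ℕ → X}
    (hx : Tendsto (fun n => ‖x n‖) atTop (𝓝 0)) : IsMeasureNull x := by
  obtain ⟨C, hC⟩ := hx.bddAbove_range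
  exact ⟨⟨C, fun n => hC ⟨n, rfl⟩⟩, fun φ hφ =>
    ⟨id, strictMono_id, Or.inr (hx.comp hφ.tendsto_atTop)⟩⟩

/-- This is the Urysohn property. Boundedness needs an argument: an unbounded sequence has a
subsequence with norms at least `n`, none of whose subsequences is bounded. -/
theorem isMeasureNull_of_subseq {X : Type*} [NormedAddCommGroup X] [NormedSpace ℂ X] {x : ℕ → X}
    (hx : ∀ φ : ℕ → ℕ, StrictMono φ → ∃ ψ : ℕ → ℕ, StrictMono ψ ∧ IsMeasureNull ((x ∘ φ) ∘ ψ)) :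
    IsMeasureNull x := by
  constructor
  · by_contra! h
    have hfreq : ∀ C : ℝ, ∃ᶠ n in atTop, C ≤ ‖x n‖ := by
      intro C hC
      obtain ⟨N, hN⟩ := eventually_atTop.1 hC
      obtain ⟨D, hD⟩ := ((Set.finite_Iio N).image fun n => ‖x n‖).bddAbove
      obtain ⟨n, hn⟩ := h (max C D)
      rcases lt_or_ge n N with h1 | h1
      · exact absurd (hD ⟨n, h1, rfl⟩) (not_le.2 ((le_max_right _ _).trans_lt hn))
      · exact hN n h1 ((le_max_left _ _).trans hn.le)
    obtain ⟨φ, hφ, hφx⟩ := extraction_forall_of_frequently fun n : ℕ => hfreq n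
    obtain ⟨ψ, hψ, ⟨C, hC⟩, -⟩ := hx φ hφ
    obtain ⟨n, hn⟩ := exists_nat_gt C
    have h1 := hφx (ψ n)
    have h2 : (n : ℝ) ≤ ψ n := by exact_mod_cast hψ.id_le n
    have h3 := hC n
    simp only [Function.comp_apply] at h3
    linarith
  · intro φ hφ
    obtain ⟨ψ, hψ, -, h⟩ := hx φ hφ
    obtain ⟨ψ', hψ', h'⟩ := h id strictMono_id
    exact ⟨ψ ∘ ψ', hψ.comp hψ', h'⟩

theorem IsLProjectionOntoCopy.apply_eq_zero_of_spans_or_tendsto {X : Type*} [NormedAddCommGroup X]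
    [NormedSpace ℂ X] {P : NormDual (NormDual X) →L[ℂ] NormDual (NormDual X)}
    (hP : IsLProjectionOntoCopy P) {x : ℕ → X} {C : ℝ} (hC : ∀ n, ‖x n‖ ≤ C)
    (hx : SpansL1Asymptotically x ∨ Tendsto (fun n => ‖x n‖) atTop (𝓝 0))
    {U : Ultrafilter ℕ} (hU : (U : Filter ℕ) ≤ atTop)
    {z : NormDual (NormDual X)} (hz : ∀ f : NormDual X, Tendsto (fun n => f (x n)) U (𝓝 (z f))) :
    P z = 0 := by
  rcases hx with hx | hx
  · exact hP.apply_eq_zero_of_spans hC hx hU hz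
  · have : z = 0 := by
      ext f
      have h1 := (f.continuous.tendsto 0).comp (tendsto_zero_iff_norm_tendsto_zero.2 hx)
      rw [map_zero] at h1
      exact tendsto_nhds_unique (hz f) (h1.mono_left hU)
    rw [this, map_zero]

/-- On a common subsequence, if `z` is a cluster point of `x n - a`, then `z + (a - b)` is one of `x
n - b`. Both are in ker P, and P fixes `a - b`. -/
theorem IsLProjectionOntoCopy.eq_of_isMeasureNull {X : Type*} [NormedAddCommGroup X]
    [NormedSpace ℂ X] {P : NormDual (NormDual X) →L[ℂ] NormDual (NormDual X)}
    (hP : IsLProjectionOntoCopy P) {x : ℕ → X} {a b : X} (ha : IsMeasureNull fun n => x n - a)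
    (hb : IsMeasureNull fun n => x n - b) : a = b := by
  obtain ⟨φ, hφ, hφa⟩ := ha.2 id strictMono_id
  obtain ⟨ψ, hψ, hψb⟩ := hb.2 φ hφ
  obtain ⟨A, hA⟩ := ha.1
  obtain ⟨B, hB⟩ := hb.1
  let y : ℕ → X := fun n => x (φ (ψ n)) - a
  have hy : SpansL1Asymptotically y ∨ Tendsto (fun n => ‖y n‖) atTop (𝓝 0) :=
    hφa.imp (fun h => h.comp hψ) fun h => h.comp hψ.tendsto_atTop
  have hU : (hyperfilter ℕ : Filter ℕ) ≤ atTop := Nat.hyperfilter_le_atTop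
  obtain ⟨z, hz⟩ := exists_tendsto_apply_of_bounded (hyperfilter ℕ) (u := y) fun n => hA _
  have h1 : P z = 0 := hP.apply_eq_zero_of_spans_or_tendsto (fun n => hA _) hy hU hz
  have h2 : P (z + NormedSpace.inclusionInDoubleDual ℂ X (a - b)) = 0 := by
    refine hP.apply_eq_zero_of_spans_or_tendsto (x := fun n => x (φ (ψ n)) - b)
      (fun n => hB _) hψb hU fun f => ?_
    refine ((hz f).add_const (f (a - b))).congr fun n => ?_
    rw [← map_add]
    congr 1
    simp [y]
  rw [map_add, h1, zero_add, hP.apply_inclusion] at h2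
  have h3 := norm_inclusionInDoubleDual (a - b)
  rw [h2] at h3
  exact sub_eq_zero.1 (norm_eq_zero.1
    (h3.symm.trans (norm_zero (E := NormDual (NormDual X)))))

/-- The right side does not mention `τ`, which is what forces uniqueness. Conversely to the axiom on
null sequences, each subsequence has a further one that is `τ`-null, and topological convergence can
be tested this way. -/
theorem IsAbstractMeasureTopology.convergesIn_iff {X : Type*} [NormedAddCommGroup X]
    [NormedSpace ℂ X] {τ : TopologicalSpace X} (hτ : IsAbstractMeasureTopology X τ)
    {x : ℕ → X} {a : X} : ConvergesIn τ x a ↔ IsMeasureNull fun n => x n - a := by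
  rw [hτ.translation]
  set y : ℕ → X := fun n => x n - a
  refine ⟨fun h => ⟨hτ.bounded_of_null y h, fun φ hφ =>
    hτ.subseq_of_null (y ∘ φ) (h.comp hφ.tendsto_atTop)⟩, fun h => ?_⟩
  obtain ⟨⟨C, hC⟩, h⟩ := h
  refine tendsto_of_subseq_tendsto fun ns hns => ?_
  obtain ⟨φ, -, hφ⟩ := strictMono_subseq_of_tendsto_atTop hns
  obtain ⟨ψ, hψ, h1⟩ := h _ hφ
  refine ⟨φ ∘ ψ, ?_⟩
  rcases h1 with h1 | h1
  · exact hτ.null_of_spans _ ⟨C, fun n => hC _⟩ h1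
  · exact (tendsto_zero_iff_norm_tendsto_zero.2 h1).mono_right
      (nhds_mono (show normTopology X ≤ τ from hτ.weaker))

theorem IsAbstractMeasureTopology.unique {X : Type*} [NormedAddCommGroup X] [NormedSpace ℂ X]
    {τ σ : TopologicalSpace X} (hτ : IsAbstractMeasureTopology X τ)
    (hσ : IsAbstractMeasureTopology X σ) : τ = σ := by
  refine TopologicalSpace.ext_isClosed fun s => ?_
  rw [← @isSeqClosed_iff_isClosed X τ hτ.sequential, ← @isSeqClosed_iff_isClosed X σ hσ.sequential]
  constructor
  · intro h x a hx hxa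
    exact h hx (hτ.convergesIn_iff.2 (hσ.convergesIn_iff.1 hxa))
  · intro h x a hx hxa
    exact h hx (hσ.convergesIn_iff.2 (hτ.convergesIn_iff.1 hxa))

theorem isOpen_of_forall_tendsto_norm_sub {X : Type*} [NormedAddCommGroup X] {U : Set X}
    (h : ∀ (x : ℕ → X) (a : X), (∀ n, x n ∈ Uᶜ) →
      Tendsto (fun n => ‖x n - a‖) atTop (𝓝 0) → a ∈ Uᶜ) : IsOpen U := by
  rw [← isClosed_compl_iff, ← isSeqClosed_iff_isClosed]
  exact fun x a hx hxa => h x a hx (tendsto_iff_norm_sub_tendsto_zero.1 hxa)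

/-- L-embeddedness enters only through uniqueness of limits; the other axioms are read off from
`IsMeasureNull`. -/
theorem IsLEmbedded.exists_isAbstractMeasureTopology {X : Type*} [NormedAddCommGroup X]
    [NormedSpace ℂ X] (hX : IsLEmbedded X) :
    ∃ τ : TopologicalSpace X, IsAbstractMeasureTopology X τ := by
  obtain ⟨P, hP⟩ := hX.exists_projection
  obtain ⟨τ, hseq, hτ⟩ := exists_sequentialSpace_of_convergence
    (fun (x : ℕ → X) a => IsMeasureNull fun n => x n - a)
    (fun a => isMeasureNull_of_tendsto (by simp))
    (fun x a φ hφ hx => hx.comp hφ)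
    (fun x a h => isMeasureNull_of_subseq h)
    (fun x a b ha hb => hP.eq_of_isMeasureNull ha hb)
  have hτ0 : ∀ x, ConvergesIn τ x 0 ↔ IsMeasureNull x := fun x => by
    simpa using hτ x 0
  refine ⟨τ, hseq, fun x a b ha hb => hP.eq_of_isMeasureNull ((hτ x a).1 ha) ((hτ x b).1 hb),
    fun U hU => ?_, fun x a => by rw [hτ, hτ0], fun x ⟨C, hC⟩ hx =>
    (hτ0 x).2 (isMeasureNull_of_spans hC hx), fun x hx => ((hτ0 x).1 hx).1, fun x hx =>
    ((hτ0 x).1 hx).2 id strictMono_id⟩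
  refine isOpen_of_forall_tendsto_norm_sub fun x a hx hxa => ?_
  exact ((@isClosed_compl_iff X τ U).2 hU).isSeqClosed hx
    ((hτ x a).2 (isMeasureNull_of_tendsto hxa))

/-! ### Building asymptotic ℓ¹-sequences near the complement of X -/

/-- Weak-star lower semicontinuity of the norm of the bidual. -/
theorem eventually_lt_norm_of_tendsto_apply {X ι : Type*} [NormedAddCommGroup X]
    [NormedSpace ℂ X] {F : Filter ι} {u : ι → X} {z : NormDual (NormDual X)}
    (hz : ∀ f : NormDual X, Tendsto (fun i => f (u i)) F (𝓝 (z f))) {r : ℝ} (hr0 : 0 ≤ r)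
    (hr : r < ‖z‖) : ∀ᶠ i in F, r < ‖u i‖ := by
  by_contra h
  have hne : (F ⊓ 𝓟 {i | ‖u i‖ ≤ r}).NeBot := by
    rw [← frequently_mem_iff_neBot]
    exact (not_eventually.1 h).mono fun i hi => not_lt.1 hi
  refine absurd (norm_le_of_tendsto_apply (F := F ⊓ 𝓟 {i | ‖u i‖ ≤ r}) hr0 ?_
    fun f => (hz f).mono_left inf_le_left) (not_le.2 hr)
  exact (inf_le_right : F ⊓ 𝓟 {i | ‖u i‖ ≤ r} ≤ _) (mem_principal_self _)

/-- A lower bound on the norm of a finite-dimensional space extends by one more vector, chosen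
weak-star close to a norm one element of the complement of `X`. -/
theorem IsLProjectionOntoCopy.eventually_lt_norm_add_smul {X V : Type*} [NormedAddCommGroup X]
    [NormedSpace ℂ X] [NormedAddCommGroup V] [NormedSpace ℂ V] [ProperSpace V]
    {P : NormDual (NormDual X) →L[ℂ] NormDual (NormDual X)} (hP : IsLProjectionOntoCopy P)
    {z : NormDual (NormDual X)} (hPz : P z = 0) (hz1 : ‖z‖ = 1)
    {F : Filter X} (hF1 : ∀ᶠ x in F, ‖x‖ ≤ 1)
    (hF : ∀ f : NormDual X, Tendsto (fun x => f x) F (𝓝 (z f)))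
    (L : V →L[ℂ] X) {q : V → ℝ} (hqc : Continuous q) (hq0 : ∀ v, 0 ≤ q v)
    (hqs : ∀ (a : ℂ) v, q (a • v) = ‖a‖ * q v) (hqL : ∀ v ≠ 0, q v < ‖L v‖)
    {c : ℝ} (hc0 : 0 ≤ c) (hc : c < 1) :
    ∀ᶠ x in F, ∀ p : V × ℂ, p ≠ 0 → q p.1 + c * ‖p.2‖ < ‖L p.1 + p.2 • x‖ := by
  have hsphere : ∀ᶠ x in F, ∀ p ∈ Metric.sphere (0 : V × ℂ) 1,
      q p.1 + c * ‖p.2‖ < ‖L p.1 + p.2 • x‖ := by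
    refine (isCompact_sphere (0 : V × ℂ) 1).induction_on
      (p := fun A => ∀ᶠ x in F, ∀ p ∈ A, q p.1 + c * ‖p.2‖ < ‖L p.1 + p.2 • x‖) (by simp)
      (fun A B hAB hB => hB.mono fun x hx p hp => hx p (hAB hp))
      (fun A B hA hB => (hA.and hB).mono fun x hx p hp => hp.elim (hx.1 p) (hx.2 p)) ?_
    rintro ⟨v, t⟩ hvt
    have hne : v ≠ 0 ∨ t ≠ 0 := by
      by_contra! h
      simp [h.1, h.2] at hvt
    have hnorm : ‖NormedSpace.inclusionInDoubleDual ℂ X (L v) + t • z‖ = ‖L v‖ + ‖t‖ := by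
      have h := hP.norm_eq (NormedSpace.inclusionInDoubleDual ℂ X (L v) + t • z)
      have hPt : P (t • z) = 0 := by
        rw [map_smul, hPz]
        exact smul_zero (A := NormDual (NormDual X)) t
      rw [map_add, hPt, add_zero, hP.apply_inclusion, add_sub_cancel_left,
        norm_inclusionInDoubleDual] at h
      rw [h, norm_smul t z, hz1, mul_one]
    -- Strictness comes from `c < 1` when `v = 0` and from `hqL` otherwise; it leaves the room
    -- needed for the perturbations below.
    have hlt : q v + c * ‖t‖ < ‖L v‖ + ‖t‖ := by
      by_cases hv : v = 0
      · have ht : t ≠ 0 := hne.resolve_left (not_not.2 hv)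
        have hq : q v = 0 := by simpa [hv] using hqs 0 v
        rw [hq, hv, map_zero, norm_zero]
        nlinarith [norm_pos_iff.2 ht]
      · nlinarith [hqL v hv, norm_nonneg t]
    obtain ⟨r, hr1, hr2⟩ := exists_between hlt
    have hr0 : 0 ≤ r := le_trans (add_nonneg (hq0 v) (mul_nonneg hc0 (norm_nonneg t))) hr1.le
    have hev : ∀ᶠ x in F, r < ‖L v + t • x‖ := by
      refine eventually_lt_norm_of_tendsto_apply (u := fun x => L v + t • x)
        (z := NormedSpace.inclusionInDoubleDual ℂ X (L v) + t • z) (fun f => ?_) hr0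
        (hnorm ▸ hr2)
      have := ((hF f).const_mul t).const_add (f (L v))
      simpa using this
    have hcont : Continuous fun p : V × ℂ =>
        q p.1 + c * ‖p.2‖ + (‖L p.1 - L v‖ + ‖p.2 - t‖) := by fun_prop
    -- Moving `(v, t)` to `p` changes `‖L v + t • x‖` by at most the bracketed term, uniformly over
    -- `‖x‖ ≤ 1`, so one `x` serves a whole neighbourhood.
    have hnhds : {p : V × ℂ | q p.1 + c * ‖p.2‖ + (‖L p.1 - L v‖ + ‖p.2 - t‖) < r} ∈
        𝓝 (v, t) :=
      (isOpen_Iio.preimage hcont).mem_nhds (by simpa using hr1)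
    refine ⟨_, mem_nhdsWithin_of_mem_nhds hnhds, ?_⟩
    filter_upwards [hev, hF1] with x hx hx1 p hp
    have h1 : ‖L v + t • x‖ ≤ ‖L p.1 + p.2 • x‖ + (‖L p.1 - L v‖ + ‖p.2 - t‖) := by
      have h2 : L v + t • x = L p.1 + p.2 • x - ((L p.1 - L v) + (p.2 - t) • x) := by
        rw [sub_smul]; abel
      have h3 : ‖(p.2 - t) • x‖ ≤ ‖p.2 - t‖ := by
        rw [norm_smul]
        exact mul_le_of_le_one_right (norm_nonneg _) hx1
      rw [h2]
      refine (norm_sub_le _ _).trans ?_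
      have := norm_add_le (L p.1 - L v) ((p.2 - t) • x)
      linarith
    have hp' : q p.1 + c * ‖p.2‖ + (‖L p.1 - L v‖ + ‖p.2 - t‖) < r := hp
    linarith
  filter_upwards [hsphere] with x hx p hp
  have hp0 : 0 < ‖p‖ := norm_pos_iff.2 hp
  let a : ℂ := ((‖p‖⁻¹ : ℝ) : ℂ)
  have ha : ‖a‖ = ‖p‖⁻¹ := by simp [a]
  have h := hx (a • p) (by
    rw [mem_sphere_zero_iff_norm, norm_smul, ha, inv_mul_cancel₀ hp0.ne'])
  rw [Prod.smul_fst, Prod.smul_snd, hqs, norm_smul, map_smul, smul_assoc, ← smul_add, norm_smul,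
    ha] at h
  have h4 : ‖p‖⁻¹ * (q p.1 + c * ‖p.2‖) < ‖p‖⁻¹ * ‖L p.1 + p.2 • x‖ := by linarith
  exact lt_of_mul_lt_mul_left h4 (inv_nonneg.2 hp0.le)

/-- A sequence can be built recursively when every admissible initial segment extends by one
term. -/
theorem exists_seq_of_forall_exists_update {X : Type*} [Nonempty X] (Good : ℕ → (ℕ → X) → Prop)
    (hcongr : ∀ n x y, (∀ i < n, x i = y i) → Good n x → Good n y) (h0 : ∀ x, Good 0 x)
    (hstep : ∀ n x, Good n x → ∃ y, Good (n + 1) (Function.update x n y)) :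
    ∃ x, ∀ n, Good n x := by
  choose! Y hY using hstep
  let S : ℕ → ℕ → X := fun n => Nat.rec (fun _ => Classical.arbitrary X)
    (fun n x => Function.update x n (Y n x)) n
  have hS : ∀ n, Good n (S n) := by
    intro n
    induction n with
    | zero => exact h0 _
    | succ n ih => exact hY n _ ih
  have hagree : ∀ m j, j < m → S m j = S (j + 1) j := by
    intro m j hj
    induction m, hj using Nat.le_induction with
    | base => rfl
    | succ m hm ih =>
      rw [← ih]
      exact Function.update_of_ne (by omega) _ _
  exact ⟨fun j => S (j + 1) j, fun n => hcongr n (S n) _ (fun i hi => hagree n i hi) (hS n)⟩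

/-- The complement of `X` in the bidual is approximated by asymptotic `ℓ¹`-sequences. -/
theorem IsLProjectionOntoCopy.exists_spansL1Asymptotically {X : Type*} [NormedAddCommGroup X]
    [NormedSpace ℂ X] {P : NormDual (NormDual X) →L[ℂ] NormDual (NormDual X)}
    (hP : IsLProjectionOntoCopy P) {z : NormDual (NormDual X)} (hPz : P z = 0) (hz1 : ‖z‖ = 1)
    (f : NormDual X) {ε : ℝ} (hε : 0 < ε) :
    ∃ x : ℕ → X, (∀ n, ‖x n‖ ≤ 1) ∧ SpansL1Asymptotically x ∧ ∀ n, ‖f (x n) - z f‖ < ε := by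
  obtain ⟨F, hFne, hF1, hF⟩ := exists_filter_tendsto_apply hz1.le
  -- Any null sequence in the open interval (0, 1) would do; the shift by 2 keeps `δ 0 < 1`.
  let δ : ℕ → ℝ := fun n => 1 / ((n : ℝ) + 2)
  have hδpos : ∀ n, 0 < δ n := fun n => by positivity
  have hδ1 : ∀ n, δ n < 1 := fun n => by
    rw [div_lt_one (by positivity)]
    linarith [n.cast_nonneg (α := ℝ)]
  have hδ : Tendsto δ atTop (𝓝 0) := by
    have := tendsto_atTop_add_const_right atTop (2 : ℝ) tendsto_natCast_atTop_atTop
    exact tendsto_const_nhds.div_atTop this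
  -- The lower bound is strict for nonzero coefficients, as the extension lemma requires of `q`.
  let Good : ℕ → (ℕ → X) → Prop := fun n x => (∀ i < n, ‖x i‖ ≤ 1 ∧ ‖f (x i) - z f‖ < ε) ∧
    ∀ α : ℕ → ℂ, (∃ i < n, α i ≠ 0) →
      ∑ i ∈ Finset.range n, (1 - δ i) * ‖α i‖ < ‖∑ i ∈ Finset.range n, α i • x i‖
  obtain ⟨x, hx⟩ : ∃ x, ∀ n, Good n x := by
    refine exists_seq_of_forall_exists_update Good ?_ (fun x => by simp [Good]) ?_
    · rintro n x y hxy ⟨h1, h2⟩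
      refine ⟨fun i hi => hxy i hi ▸ h1 i hi, fun α hα => ?_⟩
      have h3 : ∑ i ∈ Finset.range n, α i • x i = ∑ i ∈ Finset.range n, α i • y i :=
        Finset.sum_congr rfl fun i hi => by rw [hxy i (Finset.mem_range.1 hi)]
      exact h3 ▸ h2 α hα
    · rintro n x ⟨h1, h2⟩
      let L : (Fin n → ℂ) →L[ℂ] X :=
        ∑ i : Fin n, (ContinuousLinearMap.proj i).smulRight (x i)
      have hL : ∀ v, L v = ∑ i : Fin n, v i • x i := fun v => by simp [L]
      have hev := hP.eventually_lt_norm_add_smul hPz hz1 hF1 hF L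
        (q := fun v => ∑ i : Fin n, (1 - δ i) * ‖v i‖) (by fun_prop)
        (fun v => Finset.sum_nonneg fun i _ =>
          mul_nonneg (sub_nonneg.2 (hδ1 i).le) (norm_nonneg _))
        (fun a v => by
          rw [Finset.mul_sum]
          refine Finset.sum_congr rfl fun i _ => ?_
          rw [Pi.smul_apply, smul_eq_mul, norm_mul]
          ring)
        (fun v hv => by
          obtain ⟨j, hj⟩ := Function.ne_iff.1 hv
          have h3 := h2 (fun i => if h : i < n then v ⟨i, h⟩ else 0) ⟨j, j.2, by simpa using hj⟩
          rw [Finset.sum_range, Finset.sum_range] at h3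
          simpa [hL] using h3)
        (sub_nonneg.2 (hδ1 n).le) (c := 1 - δ n) (sub_lt_self 1 (hδpos n))
      have hfε : ∀ᶠ y in F, ‖f y - z f‖ < ε := by
        simpa [dist_eq_norm] using (Metric.tendsto_nhds.1 (hF f)) ε hε
      obtain ⟨y, hy, hy1, hyf⟩ := (hev.and (hF1.and hfε)).exists
      refine ⟨y, fun i hi => ?_, fun α hα => ?_⟩
      · rcases Nat.lt_succ_iff_lt_or_eq.1 hi with h | rfl
        · rw [Function.update_of_ne h.ne]
          exact h1 i h
        · rw [Function.update_self]
          exact ⟨hy1, hyf⟩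
      · have h3 := hy (fun i => α i, α n) (by
          obtain ⟨i, hi, hαi⟩ := hα
          intro h0
          rw [Prod.mk_eq_zero] at h0
          rcases Nat.lt_succ_iff_lt_or_eq.1 hi with h | rfl
          · exact hαi (congrFun h0.1 ⟨i, h⟩)
          · exact hαi h0.2)
        have h4 : ∑ i ∈ Finset.range n, α i • Function.update x n y i =
            ∑ i : Fin n, α i • x i := by
          rw [Finset.sum_range]
          exact Finset.sum_congr rfl fun i _ => by rw [Function.update_of_ne i.2.ne]
        rw [Finset.sum_range_succ, Finset.sum_range_succ, Function.update_self, h4,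
          Finset.sum_range]
        simpa only [hL] using h3
  have hx1 : ∀ n, ‖x n‖ ≤ 1 := fun n => ((hx (n + 1)).1 n n.lt_succ_self).1
  have hlow : ∀ (s : Finset ℕ) (α : ℕ → ℂ),
      ∑ n ∈ s, (1 - δ n) * ‖α n‖ ≤ ‖∑ n ∈ s, α n • x n‖ := by
    intro s α
    obtain ⟨N, hN⟩ := s.exists_nat_subset_range
    let β : ℕ → ℂ := fun n => if n ∈ s then α n else 0
    by_cases hβ : ∃ i < N, β i ≠ 0
    · have h := ((hx N).2 β hβ).le
      rw [← Finset.sum_subset hN (by intro i _ hi; simp [β, hi]),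
        ← Finset.sum_subset hN (by intro i _ hi; simp [β, hi]),
        Finset.sum_congr rfl fun i hi => by rw [show β i = α i from if_pos hi],
        Finset.sum_congr (g := fun i => α i • x i) rfl fun i hi => by
          rw [show β i = α i from if_pos hi]] at h
      exact h
    · push Not at hβ
      have hα : ∀ i ∈ s, α i = 0 := fun i hi => by
        simpa [β, hi] using hβ i (Finset.mem_range.1 (hN hi))
      rw [Finset.sum_eq_zero fun i hi => by rw [hα i hi, norm_zero, mul_zero]]
      exact norm_nonneg _
  have hx0 : ∀ n, x n ≠ 0 := by
    intro n hn
    have := hlow {n} fun _ => 1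
    simp [hn] at this
    linarith [hδ1 n]
  refine ⟨x, hx1, ⟨hx0, δ, fun n => ⟨(hδpos n).le, hδ1 n⟩, hδ, fun s α => ⟨?_, ?_⟩⟩,
    fun n => ((hx (n + 1)).1 n n.lt_succ_self).2⟩
  · have h := hlow s fun n => α n * ((‖x n‖⁻¹ : ℝ) : ℂ)
    simp only [mul_smul] at h
    refine le_trans (Finset.sum_le_sum fun n _ => ?_) h
    rw [norm_mul, Complex.norm_real, norm_inv, norm_norm]
    refine mul_le_mul_of_nonneg_left ?_ (sub_nonneg.2 (hδ1 n).le)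
    exact le_mul_of_one_le_right (norm_nonneg _)
      ((one_le_inv₀ (norm_pos_iff.2 (hx0 n))).2 (hx1 n))
  · refine (norm_sum_le _ _).trans (Finset.sum_le_sum fun n _ => ?_)
    rw [norm_smul]
    exact mul_le_of_le_one_right (norm_nonneg _) (norm_normalizedSeq_le x n)

/-! ### Identification of X^# with the annihilator of ker P -/

/-- A null sequence for the abstract measure topology has a weak-star cluster point in the
complement of `X`. -/
theorem IsLProjectionOntoCopy.exists_cluster_of_isMeasureNull {X : Type*} [NormedAddCommGroup X]
    [NormedSpace ℂ X] {P : NormDual (NormDual X) →L[ℂ] NormDual (NormDual X)}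
    (hP : IsLProjectionOntoCopy P) {x : ℕ → X} (hx : IsMeasureNull x) :
    ∃ U : Ultrafilter ℕ, (U : Filter ℕ) ≤ atTop ∧ ∃ z : NormDual (NormDual X), P z = 0 ∧
      ∀ f : NormDual X, Tendsto (fun n => f (x n)) U (𝓝 (z f)) := by
  obtain ⟨φ, hφ, hφx⟩ := hx.2 id strictMono_id
  obtain ⟨C, hC⟩ := hx.1
  obtain ⟨z, hz⟩ := exists_tendsto_apply_of_bounded (hyperfilter ℕ) (u := x ∘ φ) fun n => hC _
  refine ⟨(hyperfilter ℕ).map φ, ?_, z, ?_, hz⟩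
  · exact hφ.tendsto_atTop.mono_left Nat.hyperfilter_le_atTop
  · exact hP.apply_eq_zero_of_spans_or_tendsto (fun n => hC _) hφx Nat.hyperfilter_le_atTop hz

/-- For a cluster point `z` of `x n - a` in ker P, `a + z` is one of `x n`, so `‖a‖ + ‖z‖ = ‖a + z‖
≤ 1`. This makes the unit ball `τ`-closed. -/
theorem norm_le_one_of_convergesIn {X : Type*} [NormedAddCommGroup X]
    [NormedSpace ℂ X] {P : NormDual (NormDual X) →L[ℂ] NormDual (NormDual X)}
    (hP : IsLProjectionOntoCopy P) {τ : TopologicalSpace X} (hτ : IsAbstractMeasureTopology X τ)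
    {x : ℕ → X} {a : X} (hx : ∀ n, ‖x n‖ ≤ 1) (hxa : ConvergesIn τ x a) : ‖a‖ ≤ 1 := by
  obtain ⟨U, -, z, hPz, hz⟩ := hP.exists_cluster_of_isMeasureNull (hτ.convergesIn_iff.1 hxa)
  have h1 : ‖NormedSpace.inclusionInDoubleDual ℂ X a + z‖ ≤ 1 := by
    refine norm_le_of_tendsto_apply zero_le_one (Eventually.of_forall (f := (U : Filter ℕ)) hx)
      fun f => ?_
    simpa using (hz f).const_add (f a)
  have h2 := hP.norm_eq (NormedSpace.inclusionInDoubleDual ℂ X a + z)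
  rw [map_add, hPz, add_zero, hP.apply_inclusion, norm_inclusionInDoubleDual] at h2
  have h3 := norm_nonneg (NormedSpace.inclusionInDoubleDual ℂ X a + z -
    NormedSpace.inclusionInDoubleDual ℂ X a)
  linarith

/-- `X^#` is the space of all functionals annihilated by the complement of `X` in `X''`. -/
theorem mem_sharpDual_iff {X : Type*} [NormedAddCommGroup X]
    [NormedSpace ℂ X] {P : NormDual (NormDual X) →L[ℂ] NormDual (NormDual X)}
    (hP : IsLProjectionOntoCopy P) {τ : TopologicalSpace X} (hτ : IsAbstractMeasureTopology X τ)
    {f : NormDual X} : f ∈ sharpDual X τ ↔ ∀ z, P z = 0 → z f = 0 := by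
  constructor
  · intro hf z hPz
    by_contra hne
    have hz0 : z ≠ 0 := by
      rintro rfl
      exact hne rfl
    wlog hz1 : ‖z‖ = 1 generalizing z
    · have hpos : ‖z‖ ≠ 0 := (norm_ne_zero_iff (a := z)).2 hz0
      have hc : ((‖z‖⁻¹ : ℝ) : ℂ) ≠ 0 := by simpa using hpos
      refine this (((‖z‖⁻¹ : ℝ) : ℂ) • z) ?_ ?_ ?_ ?_
      · rw [map_smul, hPz]
        exact smul_zero (M := ℂ) (A := NormDual (NormDual X)) _
      · exact mul_ne_zero hc hne
      · exact smul_ne_zero hc hz0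
      · rw [norm_smul _ z, Complex.norm_real, norm_inv, norm_norm, inv_mul_cancel₀ hpos]
    -- This sequence is `τ`-null in the unit ball, yet `f` stays within `‖z f‖ / 2` of `z f ≠ 0`
    -- along it.
    obtain ⟨x, hx1, hxs, hxf⟩ := hP.exists_spansL1Asymptotically hPz hz1 f
      (half_pos (norm_pos_iff.2 hne))
    have h0 : ConvergesIn τ x 0 := hτ.null_of_spans x ⟨1, hx1⟩ hxs
    have hf' : @ContinuousOn X ℂ τ _ (fun x => f x) (Metric.closedBall 0 1) := hf
    have hlim : Tendsto (fun n => f (x n)) atTop (𝓝 (f 0)) := by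
      refine Tendsto.comp (hf' 0 (Metric.mem_closedBall_self zero_le_one)) ?_
      exact tendsto_inf.2 ⟨h0, tendsto_principal.2 (Eventually.of_forall fun n =>
        mem_closedBall_zero_iff.2 (hx1 n))⟩
    rw [map_zero] at hlim
    have h1 : ‖(0 : ℂ) - z f‖ ≤ ‖z f‖ / 2 :=
      le_of_tendsto (hlim.sub_const (z f)).norm (Eventually.of_forall fun n => (hxf n).le)
    rw [zero_sub, norm_neg] at h1
    linarith [norm_pos_iff.2 hne]
  · intro hf
    have hseq : ∀ (x : ℕ → X) (a : X), ConvergesIn τ x a →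
        Tendsto (fun n => f (x n)) atTop (𝓝 (f a)) := by
      intro x a hxa
      refine tendsto_of_subseq_tendsto fun ns hns => ?_
      obtain ⟨φ, -, hφ⟩ := strictMono_subseq_of_tendsto_atTop hns
      have hxφ : ConvergesIn τ (x ∘ (ns ∘ φ)) a := hxa.comp hφ.tendsto_atTop
      obtain ⟨U, hU, z, hPz, hz⟩ :=
        hP.exists_cluster_of_isMeasureNull (hτ.convergesIn_iff.1 hxφ)
      have hUlim : Tendsto (fun n => f ((x ∘ (ns ∘ φ)) n)) U (𝓝 (f a)) := by
        have := (hz f).add_const (f a)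
        rw [hf z hPz, zero_add] at this
        refine this.congr fun n => ?_
        rw [map_sub, sub_add_cancel]
      have hcl : MapClusterPt (f a) atTop fun n => f ((x ∘ (ns ∘ φ)) n) :=
        hUlim.mapClusterPt.mono (map_mono hU)
      obtain ⟨ψ, -, hψ⟩ := hcl.tendsto_subseq
      exact ⟨φ ∘ ψ, hψ⟩
    refine (@continuousOn_iff_isClosed X ℂ τ _ (fun x => f x) _).2 fun t ht => ?_
    refine ⟨(fun x => f x) ⁻¹' t ∩ Metric.closedBall 0 1, ?_, by
      rw [Set.inter_assoc, Set.inter_self]⟩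
    refine (@isSeqClosed_iff_isClosed X τ hτ.sequential _).1 fun x a hx hxa => ⟨?_, ?_⟩
    · exact ht.mem_of_tendsto (hseq x a hxa) (Eventually.of_forall fun n => (hx n).1)
    · exact mem_closedBall_zero_iff.2 (norm_le_one_of_convergesIn hP hτ
        (fun n => mem_closedBall_zero_iff.1 (hx n).2) hxa)

theorem isClosed_sharpDual {X : Type*} [NormedAddCommGroup X]
    [NormedSpace ℂ X] {P : NormDual (NormDual X) →L[ℂ] NormDual (NormDual X)}
    (hP : IsLProjectionOntoCopy P) {τ : TopologicalSpace X} (hτ : IsAbstractMeasureTopology X τ) :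
    IsClosed (sharpDual X τ : Set (NormDual X)) := by
  have h : (sharpDual X τ : Set (NormDual X)) =
      ⋂ z : {z : NormDual (NormDual X) // P z = 0}, {f | z.1 f = 0} := by
    ext f
    simp [mem_sharpDual_iff hP hτ]
  rw [h]
  exact isClosed_iInter fun z => isClosed_eq z.1.continuous continuous_const

/-! ### The Dixmier projection and M-embeddedness -/

/-- The projection of `Y'''` onto `Y'` along the annihilator of `Y`. -/
noncomputable def dixmierProjection (Y : Type*) [NormedAddCommGroup Y] [NormedSpace ℂ Y] :
    NormDual (NormDual (NormDual Y)) →L[ℂ] NormDual (NormDual (NormDual Y)) :=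
  NormedSpace.inclusionInDoubleDual ℂ (NormDual Y) ∘L
    (ContinuousLinearMap.compL ℂ Y (NormDual (NormDual Y)) ℂ).flip
      (NormedSpace.inclusionInDoubleDual ℂ Y)

theorem dixmierProjection_apply {Y : Type*} [NormedAddCommGroup Y] [NormedSpace ℂ Y]
    (φ : NormDual (NormDual (NormDual Y))) :
    dixmierProjection Y φ = NormedSpace.inclusionInDoubleDual ℂ (NormDual Y)
      (φ ∘L NormedSpace.inclusionInDoubleDual ℂ Y) := rfl

/-- The reverse inequality is the triangle inequality, and the condition is symmetric in `T` and `1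
- T`. -/
theorem isLprojection_one_sub {E : Type*} [NormedAddCommGroup E] [NormedSpace ℂ E] {T : E →L[ℂ] E}
    (hT : ∀ v, T (T v) = T v) (h : ∀ v, ‖T v‖ + ‖v - T v‖ ≤ ‖v‖) : IsLprojection E (1 - T) := by
  refine ⟨IsIdempotentElem.one_sub (ContinuousLinearMap.ext hT), fun v => ?_⟩
  have h1 : (1 - T) • v = v - T v := rfl
  have h2 : (1 - (1 - T)) • v = T v := by
    rw [sub_sub_cancel]; rfl
  rw [h1, h2]
  refine le_antisymm ?_ (by linarith [h v])
  simpa using norm_add_le (v - T v) (T v)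

/-- **Hahn-Banach** along an isometric embedding. -/
theorem exists_extension_norm_le {V W : Type*} [NormedAddCommGroup V] [NormedSpace ℂ V]
    [NormedAddCommGroup W] [NormedSpace ℂ W] (κ : V →ₗᵢ[ℂ] W) (φ : NormDual V) :
    ∃ Φ : NormDual W, (∀ v, Φ (κ v) = φ v) ∧ ‖Φ‖ ≤ ‖φ‖ := by
  obtain ⟨Φ, hΦ, hΦn⟩ := exists_extension_norm_eq (𝕜 := ℂ) (LinearMap.range κ.toLinearMap)
    (φ ∘L (κ.equivRange.symm.toContinuousLinearEquiv : _ →L[ℂ] V))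
  refine ⟨Φ, fun v => ?_, ?_⟩
  · have h2 : κ.equivRange.symm (κ.equivRange v) = v := κ.equivRange.symm_apply_apply v
    calc Φ (κ v) = φ (κ.equivRange.symm (κ.equivRange v)) := hΦ (κ.equivRange v)
      _ = φ v := by rw [h2]
  · rw [hΦn]
    refine ContinuousLinearMap.opNorm_le_bound _ (norm_nonneg φ) fun p => ?_
    have h1 := φ.le_opNorm (κ.equivRange.symm p)
    rwa [κ.equivRange.symm.norm_map] at h1

/-- The kernel of the Dixmier projection is the annihilator of the copy of `Y`, so its complementary
projection is the L-projection sought. -/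
theorem isMEmbedded_of_norm_dixmierProjection {Y : Type*} [NormedAddCommGroup Y]
    [NormedSpace ℂ Y] (h : ∀ φ : NormDual (NormDual (NormDual Y)),
      ‖dixmierProjection Y φ‖ + ‖φ - dixmierProjection Y φ‖ ≤ ‖φ‖) : IsMEmbedded Y := by
  refine ⟨1 - dixmierProjection Y, isLprojection_one_sub (fun φ => rfl) h, ?_⟩
  · ext φ
    rw [StrongDual.mem_polarSubmodule]
    constructor
    · rintro ⟨ψ, rfl⟩ _ ⟨y, rfl⟩
      exact sub_self (ψ (NormedSpace.inclusionInDoubleDual ℂ Y y))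
    · intro hφ
      refine ⟨φ, ?_⟩
      have h0 : φ ∘L NormedSpace.inclusionInDoubleDual ℂ Y = 0 :=
        ContinuousLinearMap.ext fun y => hφ _ ⟨y, rfl⟩
      have h1 : dixmierProjection Y φ = 0 := by
        rw [dixmierProjection_apply, h0, map_zero]
      show φ - dixmierProjection Y φ = φ
      rw [h1]
      exact sub_zero (G := NormDual (NormDual (NormDual Y))) φ

theorem IsLProjectionOntoCopy.exists_decomposition {X : Type*} [NormedAddCommGroup X]
    [NormedSpace ℂ X] {P : NormDual (NormDual X) →L[ℂ] NormDual (NormDual X)}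
    (hP : IsLProjectionOntoCopy P) (z : NormDual (NormDual X)) :
    ∃ (x : X) (s : NormDual (NormDual X)), P s = 0 ∧ ‖x‖ + ‖s‖ = ‖z‖ ∧
      ∀ f, z f = f x + s f := by
  obtain ⟨x, hx⟩ := hP.exists_eq z
  refine ⟨x, z - P z, ?_, ?_, fun f => ?_⟩
  · rw [map_sub, hx, hP.apply_inclusion, sub_self]
  · rw [hP.norm_eq z, hx, norm_inclusionInDoubleDual]
  · rw [hx]
    exact (add_sub_cancel (f x) (z f)).symm

/-- The adjoint of a metric surjection is isometric. -/
theorem exists_linearIsometry_dual {X W : Type*} [NormedAddCommGroup X] [NormedSpace ℂ X]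
    [NormedAddCommGroup W] [NormedSpace ℂ W] (r : X →L[ℂ] W) (hr : ∀ x, ‖r x‖ ≤ ‖x‖)
    (hsurj : ∀ w, ∃ x, r x = w ∧ ‖x‖ ≤ ‖w‖) :
    ∃ κ : NormDual W →ₗᵢ[ℂ] NormDual X, ∀ G x, κ G x = G (r x) := by
  refine ⟨{ toLinearMap := ((ContinuousLinearMap.compL ℂ X W ℂ).flip r).toLinearMap
            norm_map' := fun G => le_antisymm ?_ ?_ }, fun G x => rfl⟩
  · refine ContinuousLinearMap.opNorm_le_bound _ (norm_nonneg G) fun x => ?_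
    exact (G.le_opNorm (r x)).trans (mul_le_mul_of_nonneg_left (hr x) (norm_nonneg G))
  · refine ContinuousLinearMap.opNorm_le_bound G (norm_nonneg (G ∘L r)) fun w => ?_
    obtain ⟨x, rfl, hx⟩ := hsurj w
    exact ((G ∘L r).le_opNorm x).trans
      (mul_le_mul_of_nonneg_left hx (norm_nonneg (G ∘L r)))

/-- Spaces of functionals annihilated by the complement of an L-embedded space in its bidual are
M-embedded. -/
theorem IsLProjectionOntoCopy.isMEmbedded {X V : Type*} [NormedAddCommGroup X]
    [NormedSpace ℂ X] [NormedAddCommGroup V] [NormedSpace ℂ V]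
    {P : NormDual (NormDual X) →L[ℂ] NormDual (NormDual X)}
    (hP : IsLProjectionOntoCopy P) (j : V →ₗᵢ[ℂ] NormDual X)
    (hj : ∀ v z, P z = 0 → z (j v) = 0) : IsMEmbedded V := by
  let r : X →L[ℂ] NormDual V := j.toContinuousLinearMap.flip
  have hr : ∀ x v, r x v = j v x := fun x v => rfl
  have hrnorm : ∀ x, ‖r x‖ ≤ ‖x‖ := fun x =>
    ContinuousLinearMap.opNorm_le_bound _ (norm_nonneg x) fun v => by
      rw [hr, mul_comm, ← j.norm_map v]
      exact (j v).le_opNorm x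
  -- Extend `ψ` to X''; its component in ker P is invisible on the image of `j`, so the component in
  -- X already induces `ψ`.
  have hrsurj : ∀ ψ : NormDual V, ∃ x, r x = ψ ∧ ‖x‖ ≤ ‖ψ‖ := by
    intro ψ
    obtain ⟨Ψ, hΨ, hΨn⟩ := exists_extension_norm_le j ψ
    obtain ⟨x, s, hs, hn, hx⟩ := hP.exists_decomposition Ψ
    refine ⟨x, ContinuousLinearMap.ext fun v => ?_, ?_⟩
    · rw [hr, ← hΨ v, hx, hj v s hs, add_zero]
    · linarith [norm_nonneg s]
  obtain ⟨κ, hκ⟩ := exists_linearIsometry_dual r hrnorm hrsurj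
  have hκinc : ∀ v, κ (NormedSpace.inclusionInDoubleDual ℂ V v) = j v := fun v =>
    ContinuousLinearMap.ext fun x => hκ _ x
  refine isMEmbedded_of_norm_dixmierProjection fun φ => ?_
  obtain ⟨Φ, hΦ, hΦn⟩ := exists_extension_norm_le κ φ
  -- The Dixmier part of `φ` is `r x` and the remainder is `s` composed with `κ`, so their norms add
  -- up to at most `‖x‖ + ‖s‖ = ‖Φ‖ ≤ ‖φ‖`.
  obtain ⟨x, s, hs, hn, hx⟩ := hP.exists_decomposition Φ
  have hψ : φ ∘L NormedSpace.inclusionInDoubleDual ℂ V = r x := by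
    refine ContinuousLinearMap.ext fun v => ?_
    rw [ContinuousLinearMap.comp_apply, ← hΦ, hκinc, hx, hj v s hs, add_zero, hr]
  have h1 : ‖dixmierProjection V φ‖ ≤ ‖x‖ := by
    rw [dixmierProjection_apply, hψ, norm_inclusionInDoubleDual]
    exact hrnorm x
  have h2 : ‖φ - dixmierProjection V φ‖ ≤ ‖s‖ := by
    rw [dixmierProjection_apply, hψ]
    refine ContinuousLinearMap.opNorm_le_bound _ (norm_nonneg s) fun G => ?_
    have h3 : (φ - NormedSpace.inclusionInDoubleDual ℂ (NormDual V) (r x)) G = s (κ G) := by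
      show φ G - G (r x) = s (κ G)
      rw [← hΦ, hx, hκ, add_sub_cancel_left]
    rw [h3, ← κ.norm_map G]
    exact s.le_opNorm (κ G)
  linarith

theorem mainTheorem6 (X : Type*) [NormedAddCommGroup X] [NormedSpace ℂ X] [CompleteSpace X]
    (hX : IsLEmbedded X) :
    (∃! τ : TopologicalSpace X, IsAbstractMeasureTopology X τ) ∧
      ∀ τ : TopologicalSpace X, IsAbstractMeasureTopology X τ →
        IsClosed (sharpDual X τ : Set (NormDual X)) ∧ IsMEmbedded (sharpDual X τ) := by
  obtain ⟨P, hP⟩ := hX.exists_projection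
  obtain ⟨τ, hτ⟩ := hX.exists_isAbstractMeasureTopology
  exact ⟨⟨τ, hτ, fun σ hσ => hσ.unique hτ⟩, fun σ hσ => ⟨isClosed_sharpDual hP hσ,
    hP.isMEmbedded (sharpDual X σ).subtypeₗᵢ fun f => (mem_sharpDual_iff hP hσ).1 f.2⟩⟩
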